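/- **Theorem (Short-time orbit-level control).** *Setting.* A real, mean-zero, divergence-free vector field on $\mathbb T^3=[0,2\pi]^3$ is written $u(x)=\sum_{k\in\mathbb Z^3\setminus\{0\}}\hat u_k e^{ik\cdot x}$ with $\hat u_k\in\mathbb C^3$, $k\cdot\hat u_k=0$, $\hat u_{-k}=\overline{\hat u_k}$, and $\|u\|_{H^s}^2=\sum_{k\ne0}|k|^{2s}|\hat u_k|^2$, where $|k|$ is the Euclidean norm. For $k\neq 0$ let $P(k)=I-\frac{k\otimes k}{|k|^2}$, and for $N\ge1$ let $\Lambda_N=\{k\in\mathbb Z^3\setminus\{0\}:|k|_\infty\le N\}$. For $k,p,q=k-p\in\Lambda_N$ put $$N_{k,p}(u)=-i\,P(k)\bigl[(q\cdot\hat u_p)\,\hat u_q\bigr],$$ where $a\cdot b=\sum_j a_jb_j$. The Galerkin-truncated Navier–Stokes system with viscosity $\nu$ and datum $u_0$ is, for fields $u_N$ with Fourier modes in $\Lambda_N$, $$\partial_t\hat u_k=-\nu|k|^2\hat u_k+\sum_{p\in\Lambda_N,\;k-p\in\Lambda_N}N_{k,p}(u),\qquad \hat u_k(0)=(\hat u_0)_k,\qquad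 k\in\Lambda_N .$$ The full octahedral group $O_h$ acts on $\Lambda_N$ by signed permutations of coordinates, with orbits $\Omega_\alpha$. Define the matrices indexed by the orbits $$S_{\alpha\beta}(u)=\frac1{|\Omega_\alpha|}\sum_{k\in\Omega_\alpha}\ \sum_{p\in\Omega_\beta,\;k-p\in\Lambda_N}|k|^2\,\mathrm{Re}\bigl(\overline{\hat u_k}\cdot N_{k,p}(u)\bigr),\qquad V_N(u)_{\alpha\beta}=\tfrac12\bigl(S_{\alpha\beta}(u)+S_{\beta\alpha}(u)\bigr),$$ let $\|V_N\|_\infty$ be the maximum absolute row sum and $\rho(V_N)$ the spectral radius, and put $\nu_c^*(N,t)=\rho(V_N(u_N(t)))/N^2$. *Statement.* Let $s>5/2$. There is a constant $C_s>0$ depending only on $s$ such that for every $\nu>0$ and every $M$ there is a time $T_*=T_*(M,\nu,s)>0$, independent of $N$, with the following property. Let $u_0$ be a real, mean-zero, divergence-free field in $H^s(\mathbb T^3)$ with $\|u_0\|_{H^s}\le M$. Then for every $N\ge1$ the Galerkin system with viscosity $\nu$ and datum $u_0$ has a unique solution $u_N$ on $[0,T_*]$, and 1. $\|u_N(t)\|_{H^s}\le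 2M$ for all $t\in[0,T_*]$ and all $N\ge1$; 2. $\|V_N(u_N(t))\|_\infty\le C_s(2M)^3$ for all $t\in[0,T_*]$ and all $N\ge1$; 3. $\nu_c^*(N,t)\le C_s(2M)^3/N^2$ for all $t\in[0,T_*]$ and all $N\ge1$; hence $\nu_c^*(N,t)\to0$ as $N\to\infty$, uniformly in $t\in[0,T_*]$. -/

import Mathlib

noncomputable section

namespace GalerkinNS

/-- Wave vectors `k ∈ ℤ³`. -/
abbrev Mode := Fin 3 → ℤ

/-- A (complex, vector-valued) family of Fourier coefficients `(û_k)`, `k ∈ ℤ³`, standing for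
`u(x) = ∑_k û_k e^{i k·x}` on the torus `𝕋³ = [0, 2π]³`. -/
abbrev Coeffs := Mode → EuclideanSpace ℂ (Fin 3)

/-- The Euclidean length `|k|`. -/
def modeAbs (k : Mode) : ℝ := Real.sqrt (∑ i, (k i : ℝ) ^ 2)

/-- The bilinear product `k · v = ∑ i, k_i v_i` (no complex conjugation). -/
def dotMode (k : Mode) (v : EuclideanSpace ℂ (Fin 3)) : ℂ := ∑ i, (k i : ℂ) * v i

/-- The wave vector `k` as an element of `ℂ³`. -/
def modeVec (k : Mode) : EuclideanSpace ℂ (Fin 3) := WithLp.toLp 2 (fun i => (k i : ℂ))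

/-- The Fourier-side Leray projector `P(k) = I - k ⊗ k / |k|²` (used for `k ≠ 0`). -/
def leray (k : Mode) (v : EuclideanSpace ℂ (Fin 3)) : EuclideanSpace ℂ (Fin 3) :=
  v - (dotMode k v / ((modeAbs k : ℂ) ^ 2)) • modeVec k

/-- The coefficient family of a real-valued, mean-zero, divergence-free vector field. -/
structure IsVelocityField (a : Coeffs) : Prop where
  mean_zero : a 0 = 0
  div_free : ∀ k, dotMode k (a k) = 0
  reality : ∀ k i, a (-k) i = (starRingEnd ℂ) (a k i)

/-- Membership in `H^s(𝕋³)`: the series defining the norm converges. -/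
def MemSobolev (s : ℝ) (a : Coeffs) : Prop :=
  Summable fun k : {k : Mode // k ≠ 0} => modeAbs k ^ (2 * s) * ‖a k‖ ^ 2

/-- `‖u‖_{H^s} = (∑_{k ≠ 0} |k|^{2s} |û_k|²)^{1/2}`. -/
def sobolevNorm (s : ℝ) (a : Coeffs) : ℝ :=
  Real.sqrt (∑' k : {k : Mode // k ≠ 0}, modeAbs k ^ (2 * s) * ‖a k‖ ^ 2)

/-- `Λ_N = {k ∈ ℤ³ \ {0} : |k|_∞ ≤ N}`. -/
def latticeBox (N : ℕ) : Finset Mode :=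
  (Fintype.piFinset fun _ => Finset.Icc (-(N : ℤ)) (N : ℤ)).erase 0

/-- The contribution of the pair `(p, q)`, `q = k - p`, to the nonlinear term at mode `k`:
`N_{k,p} = -i P(k) [(q · û_p) û_q]`. -/
def interaction (a : Coeffs) (k p : Mode) : EuclideanSpace ℂ (Fin 3) :=
  -(Complex.I • leray k (dotMode (k - p) (a p) • a (k - p)))

/-- The Galerkin-truncated nonlinear term
`N_k = -i ∑_{p ∈ Λ_N, q = k - p ∈ Λ_N} P(k) [(q · û_p) û_q]`. -/
def nonlinearTerm (N : ℕ) (a : Coeffs) (k : Mode) : EuclideanSpace ℂ (Fin 3) :=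
  ∑ p ∈ (latticeBox N).filter (fun p => k - p ∈ latticeBox N), interaction a k p

/-- `u` solves, on the time interval `[0, T]`, the Galerkin-truncated Navier–Stokes system on `Λ_N`
with viscosity `ν` and initial datum the truncation of `u₀` to `Λ_N`. -/
structure IsGalerkinSolution (ν : ℝ) (N : ℕ) (u₀ : Coeffs) (T : ℝ) (u : ℝ → Coeffs) : Prop where
  velocity : ∀ t ∈ Set.Icc 0 T, IsVelocityField (u t)
  support : ∀ t ∈ Set.Icc 0 T, ∀ k ∉ latticeBox N, u t k = 0
  initial : ∀ k ∈ latticeBox N, u 0 k = u₀ k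
  ode : ∀ t ∈ Set.Icc 0 T, ∀ k ∈ latticeBox N,
    HasDerivWithinAt (fun τ => u τ k)
      (-((ν * modeAbs k ^ 2) • u t k) + nonlinearTerm N (u t) k) (Set.Icc 0 T) t

/-- The orbit of `k` under the full octahedral group `O_h`, which acts on `ℤ³` by the `48` signed
permutations of the coordinates. -/
def octahedralOrbit (k : Mode) : Finset Mode :=
  (Finset.univ : Finset (Equiv.Perm (Fin 3) × (Fin 3 → ℤˣ))).image
    fun g i => (g.2 i : ℤ) * k (g.1 i)

/-- The orbit set `𝒪_N = Λ_N / O_h`; an orbit is the finite set of its modes. -/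
def orbits (N : ℕ) : Finset (Finset Mode) := (latticeBox N).image octahedralOrbit

/-- The raw orbit-pair transfer
`S_{αβ} = |Ω_α|⁻¹ ∑_{k ∈ Ω_α} ∑_{p ∈ Ω_β, k - p ∈ Λ_N} |k|² Re (conj û_k · N_{k,p})`. -/
def transferMatrix (N : ℕ) (a : Coeffs) : Matrix (orbits N) (orbits N) ℝ :=
  fun α β => ((α : Finset Mode).card : ℝ)⁻¹ *
    ∑ k ∈ (α : Finset Mode), ∑ p ∈ (β : Finset Mode).filter (fun p => k - p ∈ latticeBox N),
      modeAbs k ^ 2 * (inner ℂ (a k) (interaction a k p)).re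

/-- The orbit-level stretching matrix `V_N`, `V_{αβ} = (S_{αβ} + S_{βα}) / 2`. -/
def stretchingMatrix (N : ℕ) (a : Coeffs) : Matrix (orbits N) (orbits N) ℝ :=
  fun α β => (transferMatrix N a α β + transferMatrix N a β α) / 2

/-- The matrix `ℓ^∞` norm, that is, the maximum absolute row sum. -/
def linftyNorm {n : Type*} [Fintype n] (A : Matrix n n ℝ) : ℝ :=
  letI := Matrix.linftyOpNormedAddCommGroup (m := n) (n := n) (α := ℝ)
  ‖A‖

/-- The spectral radius `ρ(A)` of a real square matrix: the largest modulus of its complex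
eigenvalues (the spectrum is finite, so the value in `[0, ∞]` is finite). -/
def matrixSpectralRadius {n : Type*} [Fintype n] [DecidableEq n] (A : Matrix n n ℝ) : ℝ :=
  (spectralRadius ℂ (A.map (fun x : ℝ => (x : ℂ)))).toReal

/-- The orbit-level critical threshold `ν_c^*(N) = ρ(V_N) / N²` of a field. -/
def criticalThreshold (N : ℕ) (a : Coeffs) : ℝ :=
  matrixSpectralRadius (stretchingMatrix N a) / (N : ℝ) ^ 2

end GalerkinNS

end

namespace GalerkinNS

open Finset

/-! Everything rests on an `H^s` energy estimate for `E = boxEnergy s N u` whose constants do not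
see `N`. Tested against the divergence-free `û_k`, the Leray projector disappears, and `p · û_p = 0`
turns the derivative `q = k - p` into `k`. Distributing `|k|^s` over `p` and `q` and applying
Young's inequality `ℓ² * ℓ¹ * ℓ²` bounds the nonlinear contribution to `E'` by `2 A D E`, where `D`
is the `H^{s+1}` norm and the `ℓ¹` factor costs `K √E` because `∑ |k|^(-2s)` converges. The viscous
term `-2ν D²` absorbs `D`, leaving `E' ≤ (A² / 2ν) E²`. Hence `E` at most quadruples on a time
depending only on `s`, `ν` and the size of the datum (`boxEnergy_le_of_solution`).

Existence comes from cutting off the polynomial Galerkin field outside a large ball. Along a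
solution the cut-off multiplies the field by a factor in `[0, 1]`, which the energy estimate
tolerates, so the cut-off is never active (`exists_unique_solution_of_apriori_bound`).

For the matrix, the derivative is left on `û_q`, so that the triple sum of absolute transfers is at
most `K E^(3/2)` (`sum_stretching_le`). Orbits partition the box, so each absolute row or column sum
of the transfer matrix is part of that triple sum. The spectral radius is bounded by the same
operator norm. -/

/-! ### Wave vectors and bounds for a single interaction -/

lemma norm_modeVec (k : Mode) : ‖modeVec k‖ = modeAbs k := by
  simp [EuclideanSpace.norm_eq, modeVec, modeAbs]

lemma modeAbs_nonneg (k : Mode) : 0 ≤ modeAbs k := Real.sqrt_nonneg _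

lemma modeAbs_neg (k : Mode) : modeAbs (-k) = modeAbs k := by simp [modeAbs]

lemma modeAbs_add_le (k p : Mode) : modeAbs (k + p) ≤ modeAbs k + modeAbs p := by
  have h : modeVec (k + p) = modeVec k + modeVec p := by ext i; simp [modeVec]
  simp only [← norm_modeVec, h]
  exact norm_add_le _ _

lemma one_le_modeAbs {k : Mode} (hk : k ≠ 0) : 1 ≤ modeAbs k := by
  obtain ⟨i, hi⟩ := Function.ne_iff.mp hk
  refine Real.one_le_sqrt.mpr (le_trans ?_
    (single_le_sum (f := fun i => (k i : ℝ) ^ 2) (fun j _ => sq_nonneg _) (mem_univ i)))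
  have : 0 < k i ^ 2 := by have : k i ≠ 0 := hi; positivity
  exact_mod_cast this

lemma dotMode_eq_inner (k : Mode) (v : EuclideanSpace ℂ (Fin 3)) :
    dotMode k v = inner ℂ (modeVec k) v := by
  simp [dotMode, modeVec, PiLp.inner_apply, mul_comm]

lemma norm_dotMode_le (k : Mode) (v : EuclideanSpace ℂ (Fin 3)) :
    ‖dotMode k v‖ ≤ modeAbs k * ‖v‖ := by
  rw [dotMode_eq_inner, ← norm_modeVec]
  exact norm_inner_le_norm _ _

lemma dotMode_sub_left (k p : Mode) (v : EuclideanSpace ℂ (Fin 3)) :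
    dotMode (k - p) v = dotMode k v - dotMode p v := by
  simp [dotMode, sub_mul]

lemma dotMode_modeVec (k : Mode) : dotMode k (modeVec k) = (modeAbs k : ℂ) ^ 2 := by
  rw [dotMode_eq_inner, inner_self_eq_norm_sq_to_K, norm_modeVec]; rfl

lemma dotMode_leray {k : Mode} (hk : k ≠ 0) (v : EuclideanSpace ℂ (Fin 3)) :
    dotMode k (leray k v) = 0 := by
  have h : (modeAbs k : ℂ) ≠ 0 := by
    exact_mod_cast (zero_lt_one.trans_le (one_le_modeAbs hk)).ne'
  rw [leray, dotMode_eq_inner, inner_sub_right, inner_smul_right, ← dotMode_eq_inner,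
    ← dotMode_eq_inner, dotMode_modeVec]
  field_simp
  ring

/-- The Leray projector drops out when tested against a divergence-free coefficient. -/
lemma norm_inner_interaction_le {a : Coeffs} (ha : IsVelocityField a) (k p : Mode) :
    ‖inner ℂ (a k) (interaction a k p)‖ ≤
      ‖a k‖ * (‖dotMode (k - p) (a p)‖ * ‖a (k - p)‖) := by
  have h : inner ℂ (a k) (modeVec k) = 0 := by
    rw [← inner_conj_symm, ← dotMode_eq_inner, ha.div_free, map_zero]
  rw [interaction, inner_neg_right, inner_smul_right, leray, inner_sub_right,
    inner_smul_right _ (modeVec k), h, mul_zero, sub_zero, norm_neg, norm_mul,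
    Complex.norm_I, one_mul]
  exact (norm_inner_le_norm _ _).trans_eq (by rw [norm_smul])

/-- Incompressibility of `û_p` trades `q` for `k`. The lost derivative then sits on the tested mode,
where dissipation can absorb it. -/
lemma norm_inner_interaction_le_left {a : Coeffs} (ha : IsVelocityField a) (k p : Mode) :
    ‖inner ℂ (a k) (interaction a k p)‖ ≤ ‖a k‖ * (modeAbs k * ‖a p‖ * ‖a (k - p)‖) := by
  refine (norm_inner_interaction_le ha k p).trans ?_
  rw [dotMode_sub_left, ha.div_free p, sub_zero]
  gcongr
  exact norm_dotMode_le _ _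

/-- Here the derivative stays on `û_q`: in the stretching sum `û_k` already carries `|k|²`, so no
factor needs more than two derivatives. -/
lemma norm_inner_interaction_le_right {a : Coeffs} (ha : IsVelocityField a) (k p : Mode) :
    ‖inner ℂ (a k) (interaction a k p)‖ ≤ ‖a k‖ * (modeAbs (k - p) * ‖a p‖ * ‖a (k - p)‖) := by
  refine (norm_inner_interaction_le ha k p).trans ?_
  gcongr
  exact norm_dotMode_le _ _

/-! ### The lattice box and truncated convolutions -/

lemma mem_latticeBox {N : ℕ} {k : Mode} :
    k ∈ latticeBox N ↔ k ≠ 0 ∧ ∀ i, -(N : ℤ) ≤ k i ∧ k i ≤ N := by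
  simp [latticeBox]

lemma neg_mem_latticeBox {N : ℕ} {k : Mode} : -k ∈ latticeBox N ↔ k ∈ latticeBox N := by
  simp only [mem_latticeBox, neg_ne_zero, Pi.neg_apply]
  exact and_congr_right fun _ => forall_congr' fun i => by omega

/-- Young's inequality `ℓ² * ℓ¹ * ℓ² → ℝ` for truncated convolution sums. -/
lemma sum_convolution_le (S : Finset Mode) (f g h : Mode → ℝ)
    (hg : ∀ k, 0 ≤ g k) :
    ∑ k ∈ S, ∑ p ∈ S.filter (fun p => k - p ∈ S), f k * (g p * h (k - p)) ≤
      √(∑ k ∈ S, f k ^ 2) * (∑ p ∈ S, g p) * √(∑ k ∈ S, h k ^ 2) := by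
  -- Cauchy–Schwarz in `k` for fixed `p`; the shift `k ↦ k - p` is injective and lands in `S`, so
  -- the shifted `ℓ²` norm of `h` does not exceed its norm on `S`.
  have key : ∀ p, ∑ k ∈ S.filter (fun k => k - p ∈ S), f k * h (k - p) ≤
      √(∑ k ∈ S, f k ^ 2) * √(∑ k ∈ S, h k ^ 2) := fun p => by
    refine (Real.sum_mul_le_sqrt_mul_sqrt _ _ _).trans ?_
    gcongr
    · exact filter_subset _ _
    · rw [← sum_image (f := fun q => h q ^ 2) (g := fun k => k - p)
        (fun x _ y _ hxy => sub_left_injective hxy)]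
      refine sum_le_sum_of_subset_of_nonneg ?_ fun _ _ _ => sq_nonneg _
      intro q hq
      obtain ⟨k, hk, rfl⟩ := mem_image.mp hq
      exact (mem_filter.mp hk).2
  calc ∑ k ∈ S, ∑ p ∈ S.filter (fun p => k - p ∈ S), f k * (g p * h (k - p))
      = ∑ p ∈ S, g p * ∑ k ∈ S.filter (fun k => k - p ∈ S), f k * h (k - p) := by
        simp only [sum_filter, mul_sum]
        rw [sum_comm]
        refine sum_congr rfl fun p _ => sum_congr rfl fun k _ => ?_
        split_ifs <;> ring
    _ ≤ ∑ p ∈ S, g p * (√(∑ k ∈ S, f k ^ 2) * √(∑ k ∈ S, h k ^ 2)) := by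
        gcongr with p
        · exact hg p
        · exact key p
    _ = _ := by rw [← sum_mul]; ring

lemma sum_filter_sub_comm (S : Finset Mode) (k : Mode) (F : Mode → Mode → ℝ) :
    ∑ p ∈ S.filter (fun p => k - p ∈ S), F p (k - p) =
      ∑ p ∈ S.filter (fun p => k - p ∈ S), F (k - p) p := by
  refine sum_nbij' (fun p => k - p) (fun p => k - p) ?_ ?_ ?_ ?_ ?_ <;>
    simp +contextual

/-! ### Sobolev energy on the box and control of the `ℓ¹` norm -/

/-- The homogeneous Sobolev energy of the modes in `Λ_N`. -/
noncomputable def boxEnergy (s : ℝ) (N : ℕ) (a : Coeffs) : ℝ :=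
  ∑ k ∈ latticeBox N, modeAbs k ^ (2 * s) * ‖a k‖ ^ 2

lemma modeAbs_rpow_two_mul (s : ℝ) (k : Mode) : modeAbs k ^ (2 * s) = (modeAbs k ^ s) ^ 2 := by
  rw [mul_comm, Real.rpow_mul (modeAbs_nonneg k)]; norm_cast

lemma boxEnergy_eq (s : ℝ) (N : ℕ) (a : Coeffs) :
    boxEnergy s N a = ∑ k ∈ latticeBox N, (modeAbs k ^ s * ‖a k‖) ^ 2 := by
  simp only [boxEnergy, modeAbs_rpow_two_mul, mul_pow]

lemma boxEnergy_nonneg (s : ℝ) (N : ℕ) (a : Coeffs) : 0 ≤ boxEnergy s N a := by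
  rw [boxEnergy_eq]; positivity

lemma boxEnergy_mono {r s : ℝ} (h : r ≤ s) (N : ℕ) (a : Coeffs) :
    boxEnergy r N a ≤ boxEnergy s N a := by
  refine sum_le_sum fun k hk => ?_
  gcongr
  exact one_le_modeAbs (mem_latticeBox.mp hk).1

lemma norm_le_sqrt_boxEnergy {s : ℝ} (hs : 0 ≤ s) {N : ℕ} (a : Coeffs) {k : Mode}
    (hk : k ∈ latticeBox N) : ‖a k‖ ≤ √(boxEnergy s N a) := by
  rw [boxEnergy_eq]
  refine Real.le_sqrt_of_sq_le (le_trans ?_ (single_le_sum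
    (f := fun k => (modeAbs k ^ s * ‖a k‖) ^ 2) (fun _ _ => sq_nonneg _) hk))
  gcongr
  exact le_mul_of_one_le_left (norm_nonneg _)
    (Real.one_le_rpow (one_le_modeAbs (mem_latticeBox.mp hk).1) hs)

open Module in
lemma exists_sum_modeAbs_rpow_le {r : ℝ} (hr : r < -3) :
    ∃ B : ℝ, 0 < B ∧ ∀ N : ℕ, ∑ k ∈ latticeBox N, modeAbs k ^ r ≤ B := by
  let b := ((EuclideanSpace.basisFun (Fin 3) ℝ).toBasis).restrictScalars ℤ
  have key (N : ℕ) := ZLattice.sum_piFinset_Icc_rpow_le b (d := 3) (by simp) N r (by exact_mod_cast hr)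
  -- The maximum with `1` only makes the lattice constant positive.
  refine ⟨_, lt_max_of_lt_right zero_lt_one, fun N => le_trans ?_ ((key N).trans (le_max_left _ 1))⟩
  have h (k : Mode) : ‖∑ i, k i • b i‖ = modeAbs k := by
    have : ((∑ i, k i • b i : Submodule.span ℤ _) : EuclideanSpace ℝ (Fin 3)) =
        WithLp.toLp 2 (fun i => (k i : ℝ)) := by
      ext i
      simp only [AddSubmonoidClass.coe_finsetSum, Submodule.coe_smul, b,
        Module.Basis.restrictScalars_apply, WithLp.ofLp_sum, Finset.sum_apply]
      simp
    rw [Submodule.coe_norm, this, EuclideanSpace.norm_eq, modeAbs]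
    simp
  simp only [h]
  exact sum_le_sum_of_subset_of_nonneg (erase_subset _ _)
    fun k _ _ => Real.rpow_nonneg (modeAbs_nonneg k) _

/-- Cauchy–Schwarz against `|k|^(-s)`, whose squares are summable over a rank-three lattice since
`-2s < -3`. -/
lemma exists_sum_norm_le {s : ℝ} (hs : 3 / 2 < s) :
    ∃ K : ℝ, 0 < K ∧ ∀ N a, ∑ k ∈ latticeBox N, ‖a k‖ ≤ K * √(boxEnergy s N a) := by
  obtain ⟨B, hB, hsum⟩ := exists_sum_modeAbs_rpow_le (r := 2 * (-s)) (by linarith)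
  refine ⟨√B, Real.sqrt_pos.mpr hB, fun N a => ?_⟩
  have h : ∑ k ∈ latticeBox N, ‖a k‖ =
      ∑ k ∈ latticeBox N, modeAbs k ^ (-s) * (modeAbs k ^ s * ‖a k‖) := by
    refine sum_congr rfl fun k hk => ?_
    have := zero_lt_one.trans_le (one_le_modeAbs (mem_latticeBox.mp hk).1)
    rw [← mul_assoc, ← Real.rpow_add this]
    simp
  rw [h, boxEnergy_eq]
  refine (Real.sum_mul_le_sqrt_mul_sqrt _ _ _).trans ?_
  gcongr
  simpa only [modeAbs_rpow_two_mul] using hsum N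

/-! ### The energy inequality -/

lemma modeAbs_rpow_le {s : ℝ} (hs : 0 ≤ s) (k p : Mode) :
    modeAbs k ^ s ≤ 2 ^ s * (modeAbs p ^ s + modeAbs (k - p) ^ s) := by
  have hk : modeAbs k ≤ modeAbs p + modeAbs (k - p) := by
    simpa using modeAbs_add_le p (k - p)
  have hp := modeAbs_nonneg p
  have hq := modeAbs_nonneg (k - p)
  have hps := Real.rpow_nonneg hp s
  have hqs := Real.rpow_nonneg hq s
  rcases le_total (modeAbs p) (modeAbs (k - p)) with h | h
  · calc modeAbs k ^ s ≤ (2 * modeAbs (k - p)) ^ s :=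
          Real.rpow_le_rpow (modeAbs_nonneg k) (by linarith) hs
      _ = 2 ^ s * modeAbs (k - p) ^ s := Real.mul_rpow zero_le_two hq
      _ ≤ _ := by gcongr; linarith
  · calc modeAbs k ^ s ≤ (2 * modeAbs p) ^ s :=
          Real.rpow_le_rpow (modeAbs_nonneg k) (by linarith) hs
      _ = 2 ^ s * modeAbs p ^ s := Real.mul_rpow zero_le_two hp
      _ ≤ _ := by gcongr; linarith

/-- The right-hand side of the Galerkin system at the mode `k`. -/
noncomputable def galerkinField (ν : ℝ) (N : ℕ) (a : Coeffs) (k : Mode) :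
    EuclideanSpace ℂ (Fin 3) :=
  -((ν * modeAbs k ^ 2) • a k) + nonlinearTerm N a k

lemma re_inner_nonlinearTerm_le {a : Coeffs} (ha : IsVelocityField a) (N : ℕ) (k : Mode) :
    (inner ℂ (a k) (nonlinearTerm N a k)).re ≤
      ∑ p ∈ (latticeBox N).filter (fun p => k - p ∈ latticeBox N),
        ‖a k‖ * (modeAbs k * ‖a p‖ * ‖a (k - p)‖) := by
  rw [nonlinearTerm, inner_sum, Complex.re_sum]
  exact sum_le_sum fun p _ => ((Complex.re_le_norm _).trans (norm_inner_interaction_le_left ha k p))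

/-- Of the `2s + 1` derivatives, `s + 1` stay on `û_k` and `s` move to `û_p` or `û_q`; the factor
left without weight is the one summed in `ℓ¹`. The symmetry `p ↔ q` merges the two cases, whence the
factor `2`. -/
lemma sum_re_inner_nonlinearTerm_le {s K : ℝ} (hs : 0 ≤ s)
    (hK : ∀ N a, ∑ k ∈ latticeBox N, ‖a k‖ ≤ K * √(boxEnergy s N a))
    {a : Coeffs} (ha : IsVelocityField a) (N : ℕ) :
    ∑ k ∈ latticeBox N, modeAbs k ^ (2 * s) * (inner ℂ (a k) (nonlinearTerm N a k)).re ≤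
      2 * 2 ^ s * K * √(boxEnergy (s + 1) N a) * boxEnergy s N a := by
  set f : Mode → ℝ := fun k => modeAbs k ^ (s + 1) * ‖a k‖
  set g : Mode → ℝ := fun k => ‖a k‖
  set h : Mode → ℝ := fun k => modeAbs k ^ s * ‖a k‖
  have hterm : ∀ k ∈ latticeBox N,
      modeAbs k ^ (2 * s) * (inner ℂ (a k) (nonlinearTerm N a k)).re ≤
      2 * 2 ^ s * ∑ p ∈ (latticeBox N).filter (fun p => k - p ∈ latticeBox N),
        f k * (g p * h (k - p)) := by
    intro k hk
    have hk1 := zero_lt_one.trans_le (one_le_modeAbs (mem_latticeBox.mp hk).1)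
    calc modeAbs k ^ (2 * s) * (inner ℂ (a k) (nonlinearTerm N a k)).re
        ≤ modeAbs k ^ (2 * s) *
          ∑ p ∈ (latticeBox N).filter (fun p => k - p ∈ latticeBox N),
            ‖a k‖ * (modeAbs k * ‖a p‖ * ‖a (k - p)‖) := by
          gcongr
          exact re_inner_nonlinearTerm_le ha N k
      _ ≤ ∑ p ∈ (latticeBox N).filter (fun p => k - p ∈ latticeBox N),
            (2 ^ s * (f k * (g (k - p) * h p)) + 2 ^ s * (f k * (g p * h (k - p)))) := by
          rw [mul_sum]
          refine sum_le_sum fun p _ => ?_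
          have e : modeAbs k ^ (2 * s) * (‖a k‖ * (modeAbs k * ‖a p‖ * ‖a (k - p)‖)) =
              modeAbs k ^ s * (f k * (‖a p‖ * ‖a (k - p)‖)) := by
            simp only [f, modeAbs_rpow_two_mul, Real.rpow_add_one hk1.ne']
            ring
          rw [e]
          refine (mul_le_mul_of_nonneg_right (modeAbs_rpow_le hs k p) ?_).trans_eq ?_
          · have := Real.rpow_nonneg hk1.le (s + 1)
            positivity
          · simp only [g, h]
            ring
      _ = _ := by
          rw [sum_add_distrib, sum_filter_sub_comm (latticeBox N) k
            (fun p q => 2 ^ s * (f k * (g q * h p)))]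
          simp only [← mul_sum]
          ring
  calc _ ≤ ∑ k ∈ latticeBox N, 2 * 2 ^ s *
        ∑ p ∈ (latticeBox N).filter (fun p => k - p ∈ latticeBox N),
          f k * (g p * h (k - p)) := sum_le_sum hterm
    _ ≤ 2 * 2 ^ s * (√(∑ k ∈ latticeBox N, f k ^ 2) * (∑ p ∈ latticeBox N, g p) *
        √(∑ k ∈ latticeBox N, h k ^ 2)) := by
        rw [← mul_sum]
        gcongr
        exact sum_convolution_le _ f g h fun k => norm_nonneg _
    _ ≤ 2 * 2 ^ s * (√(boxEnergy (s + 1) N a) * (K * √(boxEnergy s N a)) *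
        √(boxEnergy s N a)) := by
        rw [← boxEnergy_eq, ← boxEnergy_eq]
        gcongr
        exact hK N a
    _ = _ := by
        linear_combination (2 * 2 ^ s * K * √(boxEnergy (s + 1) N a)) *
          Real.mul_self_sqrt (boxEnergy_nonneg s N a)

/-- The viscous energy inequality: dissipation absorbs the derivative lost in the nonlinear term. -/
lemma sum_re_inner_galerkinField_le {s K ν : ℝ} (hs : 0 ≤ s) (hν : 0 < ν)
    (hK : ∀ N a, ∑ k ∈ latticeBox N, ‖a k‖ ≤ K * √(boxEnergy s N a))
    {a : Coeffs} (ha : IsVelocityField a) (N : ℕ) :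
    ∑ k ∈ latticeBox N, modeAbs k ^ (2 * s) * (2 * (inner ℂ (a k) (galerkinField ν N a k)).re) ≤
      (2 * 2 ^ s * K) ^ 2 / (2 * ν) * boxEnergy s N a ^ 2 := by
  have hsplit : ∑ k ∈ latticeBox N,
      modeAbs k ^ (2 * s) * (2 * (inner ℂ (a k) (galerkinField ν N a k)).re) =
      -(2 * ν) * boxEnergy (s + 1) N a +
      2 * ∑ k ∈ latticeBox N, modeAbs k ^ (2 * s) * (inner ℂ (a k) (nonlinearTerm N a k)).re := by
    rw [boxEnergy, mul_sum, mul_sum, ← sum_add_distrib]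
    refine sum_congr rfl fun k hk => ?_
    have hk1 := zero_lt_one.trans_le (one_le_modeAbs (mem_latticeBox.mp hk).1)
    have e : modeAbs k ^ (2 * (s + 1)) = modeAbs k ^ (2 * s) * modeAbs k ^ 2 := by
      rw [mul_add, Real.rpow_add hk1]; norm_num
    have e2 : (inner ℂ (a k) ((ν * modeAbs k ^ 2) • a k)).re = ν * modeAbs k ^ 2 * ‖a k‖ ^ 2 := by
      rw [← Complex.coe_smul, inner_smul_right, Complex.re_ofReal_mul]
      exact congrArg _ (inner_self_eq_norm_sq (𝕜 := ℂ) (a k))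
    rw [galerkinField, inner_add_right, inner_neg_right, Complex.add_re, Complex.neg_re, e2, e]
    ring
  have h := sum_re_inner_nonlinearTerm_le hs hK ha N
  rw [hsplit]
  set A := 2 * 2 ^ s * K
  set y := boxEnergy s N a
  have hD := Real.sq_sqrt (boxEnergy_nonneg (s + 1) N a)
  set D := √(boxEnergy (s + 1) N a)
  rw [← hD]
  -- Completing the square: the gap between the two sides is a square over `2ν`.
  have : A ^ 2 / (2 * ν) * y ^ 2 - 2 * (A * D * y) + 2 * ν * D ^ 2 =
      (A * y - 2 * ν * D) ^ 2 / (2 * ν) := by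
    field_simp
    ring
  have : 0 ≤ (A * y - 2 * ν * D) ^ 2 / (2 * ν) := by positivity
  linarith

/-! ### Orbits and the stretching matrix -/

/-- The triple sum dominating every row of the stretching matrix. -/
lemma sum_stretching_le {s K : ℝ} (hs : 2 ≤ s)
    (hK : ∀ N a, ∑ k ∈ latticeBox N, ‖a k‖ ≤ K * √(boxEnergy s N a))
    {a : Coeffs} (ha : IsVelocityField a) (N : ℕ) :
    ∑ k ∈ latticeBox N, ∑ p ∈ (latticeBox N).filter (fun p => k - p ∈ latticeBox N),
      |modeAbs k ^ 2 * (inner ℂ (a k) (interaction a k p)).re| ≤ K * √(boxEnergy s N a) ^ 3 := by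
  have h1 : ∑ k ∈ latticeBox N, (modeAbs k ^ 2 * ‖a k‖) ^ 2 ≤ boxEnergy s N a := by
    refine le_trans (le_of_eq ?_) (boxEnergy_mono hs N a)
    rw [boxEnergy_eq]
    norm_cast
  have h2 : ∑ k ∈ latticeBox N, (modeAbs k * ‖a k‖) ^ 2 ≤ boxEnergy s N a := by
    refine le_trans (le_of_eq ?_) (boxEnergy_mono (one_le_two.trans hs) N a)
    simp [boxEnergy_eq]
  calc _ ≤ ∑ k ∈ latticeBox N, ∑ p ∈ (latticeBox N).filter (fun p => k - p ∈ latticeBox N),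
        (modeAbs k ^ 2 * ‖a k‖) * (‖a p‖ * (modeAbs (k - p) * ‖a (k - p)‖)) := by
        refine sum_le_sum fun k _ => sum_le_sum fun p _ => ?_
        rw [abs_mul, abs_of_nonneg (sq_nonneg _)]
        refine (mul_le_mul_of_nonneg_left ((Complex.abs_re_le_norm _).trans
          (norm_inner_interaction_le_right ha k p)) (sq_nonneg _)).trans_eq ?_
        ring
    _ ≤ √(boxEnergy s N a) * (K * √(boxEnergy s N a)) * √(boxEnergy s N a) := by
        have := (sum_nonneg fun k _ => norm_nonneg (a k)).trans (hK N a)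
        refine (sum_convolution_le _ (fun k => modeAbs k ^ 2 * ‖a k‖) (fun k => ‖a k‖)
          (fun k => modeAbs k * ‖a k‖) fun k => norm_nonneg _).trans ?_
        gcongr
        exact hK N a
    _ = _ := by ring

lemma mem_octahedralOrbit_self (k : Mode) : k ∈ octahedralOrbit k :=
  mem_image.mpr ⟨(1, 1), mem_univ _, by ext; simp⟩

lemma octahedralOrbit_subset {N : ℕ} {k : Mode} (hk : k ∈ latticeBox N) :
    octahedralOrbit k ⊆ latticeBox N := by
  intro m hm
  obtain ⟨⟨σ, ε⟩, -, rfl⟩ := mem_image.mp hm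
  obtain ⟨h0, hN⟩ := mem_latticeBox.mp hk
  refine mem_latticeBox.mpr ⟨fun h => h0 ?_, fun i => ?_⟩
  · ext i
    simpa using congrFun h (σ.symm i)
  · have := hN (σ i)
    rcases Int.units_eq_one_or (ε i) with h | h <;> simp [h] <;> omega

lemma octahedralOrbit_smul (g : Equiv.Perm (Fin 3) × (Fin 3 → ℤˣ)) (k : Mode) :
    octahedralOrbit k ⊆ octahedralOrbit (fun i => (g.2 i : ℤ) * k (g.1 i)) := by
  intro m hm
  obtain ⟨⟨σ, ε⟩, -, rfl⟩ := mem_image.mp hm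
  -- The coordinate `g.1⁻¹ (σ i)` of the transformed vector carries `k (σ i)`; the sign that `g`
  -- attached there has to be cancelled.
  refine mem_image.mpr ⟨(g.1⁻¹ * σ, fun i => ε i * (g.2 (g.1⁻¹ (σ i)))⁻¹), mem_univ _, ?_⟩
  ext i
  simp only [Units.val_mul, Equiv.Perm.mul_apply]
  rw [mul_assoc, ← mul_assoc (((g.2 (g.1⁻¹ (σ i)))⁻¹ : ℤˣ) : ℤ), Units.inv_mul, one_mul]
  simp

lemma octahedralOrbit_eq_of_mem {k m : Mode} (hm : m ∈ octahedralOrbit k) :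
    octahedralOrbit m = octahedralOrbit k := by
  obtain ⟨g, -, rfl⟩ := mem_image.mp hm
  have h := octahedralOrbit_smul g k
  refine Subset.antisymm ?_ h
  -- Some `g'` returns the transformed vector to `k`; the same inclusion for `g'` is the reverse
  -- one.
  obtain ⟨g', -, hg'⟩ := mem_image.mp (h (mem_octahedralOrbit_self k))
  have := octahedralOrbit_smul g' (fun i => (g.2 i : ℤ) * k (g.1 i))
  rwa [hg'] at this

lemma orbit_subset {N : ℕ} (α : orbits N) : (α : Finset Mode) ⊆ latticeBox N := by
  obtain ⟨k, hk, h⟩ := mem_image.mp α.2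
  exact h ▸ octahedralOrbit_subset hk

/-- The orbits partition the box: the fibre of `octahedralOrbit` over `α` is `α` itself. -/
lemma sum_orbits_sum (N : ℕ) (F : Mode → ℝ) :
    ∑ α : orbits N, ∑ k ∈ (α : Finset Mode), F k = ∑ k ∈ latticeBox N, F k := by
  rw [← sum_fiberwise_of_maps_to (s := latticeBox N) (t := orbits N) (g := octahedralOrbit)
    (fun k hk => mem_image_of_mem _ hk) F, ← sum_coe_sort (orbits N)]
  refine sum_congr rfl fun α _ => sum_congr ?_ fun _ _ => rfl
  ext m
  rw [mem_filter]
  obtain ⟨k, hk, h⟩ := mem_image.mp α.2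
  refine ⟨fun hm => ⟨orbit_subset α hm, ?_⟩, fun hm => hm.2 ▸ mem_octahedralOrbit_self m⟩
  rw [← h] at hm ⊢
  exact octahedralOrbit_eq_of_mem hm

lemma abs_transferMatrix_le (N : ℕ) (a : Coeffs) (α β : orbits N) :
    |transferMatrix N a α β| ≤ ∑ k ∈ (α : Finset Mode), ∑ p ∈ (β : Finset Mode),
      if k - p ∈ latticeBox N then
        |modeAbs k ^ 2 * (inner ℂ (a k) (interaction a k p)).re| else 0 := by
  rw [transferMatrix, abs_mul]
  have hc : |((α : Finset Mode).card : ℝ)⁻¹| ≤ 1 := by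
    rw [abs_of_nonneg (by positivity)]
    exact Nat.cast_inv_le_one _
  refine (mul_le_of_le_one_left (abs_nonneg _) hc).trans ((abs_sum_le_sum_abs _ _).trans ?_)
  refine sum_le_sum fun k _ => ?_
  rw [← sum_filter]
  exact abs_sum_le_sum_abs _ _

/-- Along a row of the transfer matrix the orbits partition the range of `p`, along a column that of
`k`. Either absolute sum is thus at most the full triple sum, and symmetrizing averages the two
bounds. -/
lemma linftyNorm_stretchingMatrix_le {s K : ℝ} (hs : 2 ≤ s)
    (hK : ∀ N a, ∑ k ∈ latticeBox N, ‖a k‖ ≤ K * √(boxEnergy s N a))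
    {a : Coeffs} (ha : IsVelocityField a) (N : ℕ) :
    linftyNorm (stretchingMatrix N a) ≤ K * √(boxEnergy s N a) ^ 3 := by
  have htri := sum_stretching_le hs hK ha N
  set B := K * √(boxEnergy s N a) ^ 3
  set G : Mode → Mode → ℝ := fun k p => if k - p ∈ latticeBox N then
    |modeAbs k ^ 2 * (inner ℂ (a k) (interaction a k p)).re| else 0
  have hG : ∀ k p, 0 ≤ G k p := fun k p => by simp only [G]; positivity
  have htot : ∑ k ∈ latticeBox N, ∑ p ∈ latticeBox N, G k p ≤ B := by
    simpa only [sum_filter, G] using htri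
  have hB : 0 ≤ B := (sum_nonneg fun k _ => sum_nonneg fun p _ => hG k p).trans htot
  have hrow : ∀ α : orbits N, ∑ β, |transferMatrix N a α β| ≤ B := fun α => by
    refine (sum_le_sum fun β _ => abs_transferMatrix_le N a α β).trans ?_
    rw [sum_comm]
    refine (sum_congr rfl fun k _ => sum_orbits_sum N (G k)).trans_le ?_
    exact (sum_le_sum_of_subset_of_nonneg (orbit_subset α)
      fun k _ _ => sum_nonneg fun p _ => hG k p).trans htot
  have hcol : ∀ α : orbits N, ∑ β, |transferMatrix N a β α| ≤ B := fun α => by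
    refine (sum_le_sum fun β _ => abs_transferMatrix_le N a β α).trans ?_
    rw [sum_orbits_sum N (fun k => ∑ p ∈ (α : Finset Mode), G k p)]
    exact (sum_le_sum fun k _ => sum_le_sum_of_subset_of_nonneg (orbit_subset α)
      fun p _ _ => hG k p).trans htot
  let _ := Matrix.linftyOpNormedAddCommGroup (m := orbits N) (n := orbits N) (α := ℝ)
  change ‖stretchingMatrix N a‖ ≤ B
  rw [Matrix.linfty_opNorm_def, ← Real.coe_toNNReal B hB, NNReal.coe_le_coe]
  refine Finset.sup_le fun α _ => ?_
  rw [← NNReal.coe_le_coe, Real.coe_toNNReal B hB, NNReal.coe_sum]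
  calc ∑ β, ((‖stretchingMatrix N a α β‖₊ : NNReal) : ℝ)
      ≤ ∑ β, (|transferMatrix N a α β| + |transferMatrix N a β α|) / 2 := by
        refine sum_le_sum fun β _ => ?_
        rw [coe_nnnorm, Real.norm_eq_abs, stretchingMatrix, abs_div, abs_two]
        gcongr
        exact abs_add_le _ _
    _ ≤ B := by
        rw [← sum_div, sum_add_distrib]
        linarith [hrow α, hcol α]

/-- A Banach algebra norm dominates the spectral radius, and complexifying the entries preserves the
`ℓ^∞` operator norm. Nonemptiness of `n` gives `‖1‖ = 1`. -/
lemma matrixSpectralRadius_le {n : Type*} [Fintype n] [DecidableEq n] [Nonempty n]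
    (A : Matrix n n ℝ) : matrixSpectralRadius A ≤ linftyNorm A := by
  let _ := Matrix.linftyOpNormedRing (n := n) (α := ℂ)
  let _ := Matrix.linftyOpNormedAlgebra (R := ℂ) (n := n) (α := ℂ)
  have : NormOneClass (Matrix n n ℂ) := Matrix.linfty_opNormOneClass
  have : CompleteSpace (Matrix n n ℂ) := FiniteDimensional.complete ℂ _
  have h := spectrum.spectralRadius_le_nnnorm (𝕜 := ℂ) (A.map (fun x : ℝ => (x : ℂ)))
  have h2 := ENNReal.toReal_mono ENNReal.coe_ne_top h
  refine h2.trans (le_of_eq ?_)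
  let _ := Matrix.linftyOpNormedAddCommGroup (m := n) (n := n) (α := ℝ)
  change ‖A.map (fun x : ℝ => (x : ℂ))‖ = ‖A‖
  rw [Matrix.linfty_opNorm_def, Matrix.linfty_opNorm_def]
  simp

/-! ### Solving ordinary differential equations under an a priori bound -/

open Set in
/-- Global existence and uniqueness on `[0, T]` for a `C¹` vector field on a finite-dimensional
space, given an a priori bound that is stable under damping of the field. -/
theorem exists_unique_solution_of_apriori_bound {E : Type*} [NormedAddCommGroup E]
    [NormedSpace ℝ E] [FiniteDimensional ℝ E] {F : E → E} (hF : ContDiff ℝ 1 F) (x₀ : E)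
    {R T : ℝ} (hT : 0 < T)
    (hbound : ∀ (θ : ℝ → ℝ) (x : ℝ → E), (∀ t, 0 ≤ θ t ∧ θ t ≤ 1) → x 0 = x₀ →
      (∀ t ∈ Icc 0 T, HasDerivWithinAt x (θ t • F (x t)) (Icc 0 T) t) →
      ∀ t ∈ Icc 0 T, ‖x t‖ ≤ R) :
    ∃ x : ℝ → E, x 0 = x₀ ∧ (∀ t ∈ Icc 0 T, HasDerivWithinAt x (F (x t)) (Icc 0 T) t) ∧
      ∀ y : ℝ → E, y 0 = x₀ → (∀ t ∈ Icc 0 T, HasDerivWithinAt y (F (y t)) (Icc 0 T) t) →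
        ∀ t ∈ Icc 0 T, y t = x t := by
  let χ : ContDiffBump (0 : E) := ⟨|R| + 1, |R| + 2, by positivity, by linarith⟩
  let G : E → E := fun x => χ x • F x
  have hG : ContDiff ℝ 1 G := χ.contDiff.smul hF
  have hsupp : HasCompactSupport G := χ.hasCompactSupport.smul_right
  obtain ⟨L, hL⟩ := hG.continuous.bounded_above_of_compact_support hsupp
  obtain ⟨K, hK⟩ := ContDiff.lipschitzWith_of_hasCompactSupport hsupp hG one_ne_zero
  have hL0 : 0 ≤ L := (norm_nonneg _).trans (hL 0)
  have hGF : ∀ x, ‖x‖ ≤ R → G x = F x := fun x hx => by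
    have : χ x = 1 := χ.one_of_mem_closedBall (by
      rw [mem_closedBall_zero_iff]
      exact hx.trans ((le_abs_self R).trans (by simp [χ])))
    simp [G, this]
  -- As `G` is bounded by `L` everywhere, a ball of radius `L T` serves for the whole interval.
  have hPL : IsPicardLindelof (fun _ => G) (tmin := 0) (tmax := T) ⟨0, by simp [hT.le]⟩ x₀
      (L.toNNReal * T.toNNReal) 0 L.toNNReal K :=
    { lipschitzOnWith := fun t _ => hK.lipschitzOnWith
      continuousOn := fun x _ => continuousOn_const
      norm_le := fun t _ x _ => (hL x).trans (Real.le_coe_toNNReal L)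
      mul_max_le := by simp [hT.le] }
  obtain ⟨x, hx0, hx⟩ := hPL.exists_eq_forall_mem_Icc_hasDerivWithinAt₀
  -- Along its own solution the cut-off field is `F` damped by `θ t = χ (x t)`, so the a priori
  -- bound holds and confines `x` to the ball where `G = F`.
  have hxR := hbound (fun t => χ (x t)) x (fun t => ⟨χ.nonneg, χ.le_one⟩) hx0 hx
  have hxF : ∀ t ∈ Icc 0 T, HasDerivWithinAt x (F (x t)) (Icc 0 T) t := fun t ht => by
    rw [← hGF _ (hxR t ht)]
    exact hx t ht
  refine ⟨x, hx0, hxF, fun y hy0 hy => ?_⟩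
  have hyR := hbound (fun _ => 1) y (fun _ => ⟨zero_le_one, le_rfl⟩) hy0 (by simpa using hy)
  have hright : ∀ t ∈ Ico 0 T, Icc 0 T ∈ nhdsWithin t (Ici t) := fun t ht =>
    Filter.mem_of_superset (Icc_mem_nhdsGE ht.2) (Icc_subset_Icc_left ht.1)
  refine ODE_solution_unique (v := fun _ => G) (K := K) (fun _ => hK)
    (fun t ht => (hy t ht).continuousWithinAt) (fun t ht => ?_)
    (fun t ht => (hx t ht).continuousWithinAt) (fun t ht => ?_) (hy0.trans hx0.symm)
  · rw [hGF _ (hyR t (Ico_subset_Icc_self ht))]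
    exact (hy t (Ico_subset_Icc_self ht)).mono_of_mem_nhdsWithin (hright t ht)
  · exact (hx t (Ico_subset_Icc_self ht)).mono_of_mem_nhdsWithin (hright t ht)

/-- A nonnegative function with `y' ≤ c y²` at most quadruples on `[0, 3 / (17 c m²)]` when
`y 0 ≤ m²`. -/
lemma le_four_mul_sq_of_deriv_le {y y' : ℝ → ℝ} {c m T : ℝ} (hc : 0 < c) (hm : 0 < m)
    (hT : T ≤ 3 / (17 * c * m ^ 2)) (hnonneg : ∀ t, 0 ≤ y t) (h0 : y 0 ≤ m ^ 2)
    (hy : ∀ t ∈ Set.Icc 0 T, HasDerivWithinAt y (y' t) (Set.Icc 0 T) t)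
    (hy' : ∀ t ∈ Set.Icc 0 T, y' t ≤ c * y t ^ 2) :
    ∀ t ∈ Set.Icc 0 T, y t ≤ 4 * m ^ 2 := by
  have hB : ∀ t ≤ T, m ^ 2 + 17 * c * m ^ 4 * t ≤ 4 * m ^ 2 := fun t ht => by
    have : 17 * c * m ^ 4 * t ≤ 17 * c * m ^ 4 * (3 / (17 * c * m ^ 2)) := by
      gcongr
      exact ht.trans hT
    have e : 17 * c * m ^ 4 * (3 / (17 * c * m ^ 2)) = 3 * m ^ 2 := by field_simp
    linarith
  -- Below `4 m²` the growth rate is at most `16 c m⁴`. A line of slope `17 c m⁴` is strictly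
  -- steeper, as the comparison requires, and climbs from `m²` to `4 m²` in time `3 / (17 c m²)`.
  have key := image_le_of_deriv_right_lt_deriv_boundary (f := y) (f' := y') (a := 0) (b := T)
    (B := fun t => m ^ 2 + 17 * c * m ^ 4 * t) (B' := fun _ => 17 * c * m ^ 4)
    (fun t ht => (hy t ht).continuousWithinAt)
    (fun t ht => (hy t (Set.Ico_subset_Icc_self ht)).mono_of_mem_nhdsWithin
      (Filter.mem_of_superset (Icc_mem_nhdsGE ht.2) (Set.Icc_subset_Icc_left ht.1)))
    (by simpa using h0)
    (fun t => by simpa using ((hasDerivAt_id t).const_mul (17 * c * m ^ 4)).const_add (m ^ 2))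
    (fun t ht heq => by
      refine (hy' t (Set.Ico_subset_Icc_self ht)).trans_lt ?_
      have h1 : y t ≤ 4 * m ^ 2 := heq ▸ hB t ht.2.le
      calc c * y t ^ 2 ≤ c * (4 * m ^ 2) ^ 2 := by
            have := hnonneg t
            gcongr
        _ = 16 * c * m ^ 4 := by ring
        _ < 17 * c * m ^ 4 := by
            have : 0 < c * m ^ 4 := by positivity
            linarith)
  exact fun t ht => (key ht).trans (hB t ht.2)

lemma boxEnergy_hasDerivWithinAt (s : ℝ) (N : ℕ) {u : ℝ → Coeffs} {u' : Coeffs} {S : Set ℝ} {t : ℝ}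
    (hu : ∀ k ∈ latticeBox N, HasDerivWithinAt (fun τ => u τ k) (u' k) S t) :
    HasDerivWithinAt (fun τ => boxEnergy s N (u τ))
      (∑ k ∈ latticeBox N, modeAbs k ^ (2 * s) * (2 * (inner ℂ (u t k) (u' k)).re)) S t := by
  refine HasDerivWithinAt.fun_sum fun k hk => HasDerivWithinAt.const_mul _ ?_
  have h := Complex.reCLM.hasFDerivAt.comp_hasDerivWithinAt t ((hu k hk).inner ℂ (hu k hk))
  have e1 : ∀ v w : EuclideanSpace ℂ (Fin 3), (inner ℂ w v).re = (inner ℂ v w).re := fun v w => by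
    rw [← inner_conj_symm, Complex.conj_re]
  have e2 : ∀ v : EuclideanSpace ℂ (Fin 3), ‖v‖ ^ 2 = (inner ℂ v v).re := fun v =>
    (inner_self_eq_norm_sq (𝕜 := ℂ) v).symm
  simp only [e2]
  refine h.congr_deriv ?_
  rw [Complex.reCLM_apply, Complex.add_re, e1 (u t k)]
  ring

/-- The a priori `H^s` bound, stable under damping of the vector field. -/
lemma boxEnergy_le_of_solution {s K ν : ℝ} (hs : 0 ≤ s) (hν : 0 < ν) (hK0 : 0 < K)
    (hK : ∀ N a, ∑ k ∈ latticeBox N, ‖a k‖ ≤ K * √(boxEnergy s N a)) {N : ℕ} {m T : ℝ}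
    (hm : 0 < m) (hT : T ≤ 3 / (17 * ((2 * 2 ^ s * K) ^ 2 / (2 * ν)) * m ^ 2))
    {θ : ℝ → ℝ} (hθ : ∀ t, 0 ≤ θ t ∧ θ t ≤ 1) {u : ℝ → Coeffs} (h0 : boxEnergy s N (u 0) ≤ m ^ 2)
    (hu : ∀ t ∈ Set.Icc 0 T, IsVelocityField (u t))
    (hode : ∀ t ∈ Set.Icc 0 T, ∀ k ∈ latticeBox N,
      HasDerivWithinAt (fun τ => u τ k) (θ t • galerkinField ν N (u t) k) (Set.Icc 0 T) t) :
    ∀ t ∈ Set.Icc 0 T, boxEnergy s N (u t) ≤ 4 * m ^ 2 := by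
  have hc : 0 < (2 * 2 ^ s * K) ^ 2 / (2 * ν) := by positivity
  refine le_four_mul_sq_of_deriv_le hc hm hT (fun t => boxEnergy_nonneg s N _) h0
    (fun t ht => boxEnergy_hasDerivWithinAt s N (hode t ht)) fun t ht => ?_
  have e : ∑ k ∈ latticeBox N, modeAbs k ^ (2 * s) *
      (2 * (inner ℂ (u t k) (θ t • galerkinField ν N (u t) k)).re) =
      θ t * ∑ k ∈ latticeBox N, modeAbs k ^ (2 * s) *
        (2 * (inner ℂ (u t k) (galerkinField ν N (u t) k)).re) := by
    rw [mul_sum]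
    refine sum_congr rfl fun k _ => ?_
    rw [← Complex.coe_smul, inner_smul_right, Complex.re_ofReal_mul]
    ring
  rw [e]
  refine (mul_le_mul_of_nonneg_left
    (sum_re_inner_galerkinField_le hs hν hK (hu t ht) N) (hθ t).1).trans ?_
  exact mul_le_of_le_one_left (by positivity) (hθ t).2

/-! ### The Galerkin system on the space of velocity fields -/

lemma dotMode_add (k : Mode) (v w : EuclideanSpace ℂ (Fin 3)) :
    dotMode k (v + w) = dotMode k v + dotMode k w := by
  rw [dotMode_eq_inner, dotMode_eq_inner, dotMode_eq_inner, inner_add_right]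

lemma dotMode_smul (k : Mode) (c : ℂ) (v : EuclideanSpace ℂ (Fin 3)) :
    dotMode k (c • v) = c * dotMode k v := by
  rw [dotMode_eq_inner, inner_smul_right, dotMode_eq_inner]

lemma dotMode_real_smul (k : Mode) (c : ℝ) (v : EuclideanSpace ℂ (Fin 3)) :
    dotMode k (c • v) = c * dotMode k v := by
  rw [← Complex.coe_smul, dotMode_smul]

lemma dotMode_zero (k : Mode) : dotMode k 0 = 0 := by simp [dotMode]

lemma dotMode_neg_of_conj (k : Mode) {v w : EuclideanSpace ℂ (Fin 3)}
    (h : ∀ i, w i = (starRingEnd ℂ) (v i)) :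
    dotMode (-k) w = -(starRingEnd ℂ) (dotMode k v) := by
  simp [dotMode, h, map_sum]

lemma dotMode_nonlinearTerm (N : ℕ) (a : Coeffs) {k : Mode} (hk : k ≠ 0) :
    dotMode k (nonlinearTerm N a k) = 0 := by
  rw [nonlinearTerm, dotMode_eq_inner, inner_sum]
  refine sum_eq_zero fun p _ => ?_
  rw [← dotMode_eq_inner, interaction, ← smul_neg, dotMode_smul, ← neg_one_smul ℂ, dotMode_smul,
    dotMode_leray hk, mul_zero, mul_zero]

/-- Conjugation reverses `i` and negating the modes reverses the single derivative; the two signs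
cancel. -/
lemma interaction_neg_neg {a : Coeffs} (ha : IsVelocityField a) (k p : Mode) (i : Fin 3) :
    interaction a (-k) (-p) i = (starRingEnd ℂ) (interaction a k p i) := by
  have hq : -k - -p = -(k - p) := by abel
  have h1 : dotMode (-(k - p)) (a (-p)) = -(starRingEnd ℂ) (dotMode (k - p) (a p)) :=
    dotMode_neg_of_conj _ (ha.reality p)
  have h2 : dotMode (-k) (a (-(k - p))) = -(starRingEnd ℂ) (dotMode k (a (k - p))) :=
    dotMode_neg_of_conj _ (ha.reality (k - p))
  simp only [interaction, leray, hq, h1, dotMode_smul, h2, modeAbs_neg, PiLp.neg_apply,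
    PiLp.smul_apply, PiLp.sub_apply, smul_eq_mul, ha.reality (k - p) i, modeVec, map_neg, map_mul,
    map_sub, map_div₀, map_pow, Complex.conj_I, Complex.conj_ofReal, Pi.neg_apply, map_intCast,
    Int.cast_neg]
  ring

lemma nonlinearTerm_neg {a : Coeffs} (ha : IsVelocityField a) (N : ℕ) (k : Mode) (i : Fin 3) :
    nonlinearTerm N a (-k) i = (starRingEnd ℂ) (nonlinearTerm N a k i) := by
  simp only [nonlinearTerm, WithLp.ofLp_sum, Finset.sum_apply, map_sum]
  refine sum_nbij' (fun p => -p) (fun p => -p) ?_ ?_ (by simp) (by simp) ?_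
  · intro p hp
    rw [mem_filter] at hp ⊢
    rw [neg_mem_latticeBox, ← neg_mem_latticeBox (k := k - -p)]
    exact ⟨hp.1, by convert hp.2 using 1; abel⟩
  · intro p hp
    rw [mem_filter] at hp ⊢
    rw [neg_mem_latticeBox, ← neg_mem_latticeBox (k := -k - -p)]
    exact ⟨hp.1, by convert hp.2 using 1; abel⟩
  · intro p _
    rw [← interaction_neg_neg ha, neg_neg]

/-- The constraints are preserved by the field, so the system is an equation on the subspace of
velocity fields, where the energy inequality holds at every state. -/
lemma galerkinField_isVelocityField {a : Coeffs} (ha : IsVelocityField a) (ν : ℝ) (N : ℕ) :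
    IsVelocityField fun k => if k ∈ latticeBox N then galerkinField ν N a k else 0 where
  mean_zero := if_neg fun h => (mem_latticeBox.mp h).1 rfl
  div_free k := by
    split_ifs with hk
    · rw [galerkinField, dotMode_add, dotMode_nonlinearTerm N a (mem_latticeBox.mp hk).1,
        ← neg_smul, dotMode_real_smul, ha.div_free, mul_zero, add_zero]
    · exact dotMode_zero k
  reality k i := by
    simp only [neg_mem_latticeBox]
    split_ifs with hk
    · simp only [galerkinField, PiLp.add_apply, PiLp.neg_apply, PiLp.smul_apply, modeAbs_neg,
        nonlinearTerm_neg ha, ha.reality k i, map_add, map_neg, Complex.real_smul, map_mul,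
        Complex.conj_ofReal]
    · simp

/-- Extension by zero of a family indexed by `Λ_N`. -/
noncomputable def extendByZero (N : ℕ) :
    (latticeBox N → EuclideanSpace ℂ (Fin 3)) →ₗ[ℝ] Coeffs where
  toFun x k := if h : k ∈ latticeBox N then x ⟨k, h⟩ else 0
  map_add' x y := by
    ext k : 1
    by_cases h : k ∈ latticeBox N <;> simp [h]
  map_smul' c x := by
    ext k : 1
    by_cases h : k ∈ latticeBox N <;> simp [h]

lemma extendByZero_of_mem {N : ℕ} (x : latticeBox N → EuclideanSpace ℂ (Fin 3)) {k : Mode}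
    (hk : k ∈ latticeBox N) : extendByZero N x k = x ⟨k, hk⟩ := dif_pos hk

lemma extendByZero_of_notMem {N : ℕ} (x : latticeBox N → EuclideanSpace ℂ (Fin 3)) {k : Mode}
    (hk : k ∉ latticeBox N) : extendByZero N x k = 0 := dif_neg hk

lemma extendByZero_restrict {N : ℕ} (a : Coeffs) :
    extendByZero N (fun k => a k) = fun k => if k ∈ latticeBox N then a k else 0 := by
  ext k : 1
  by_cases h : k ∈ latticeBox N <;> simp [extendByZero, h]

lemma extendByZero_restrict_of_support {N : ℕ} {a : Coeffs} (ha : ∀ k ∉ latticeBox N, a k = 0) :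
    extendByZero N (fun k => a k) = a := by
  rw [extendByZero_restrict]
  ext k : 1
  by_cases h : k ∈ latticeBox N <;> simp [h, ha]

/-- The finite-dimensional real space of velocity fields with modes in `Λ_N`. -/
noncomputable def velocitySpace (N : ℕ) :
    Submodule ℝ (latticeBox N → EuclideanSpace ℂ (Fin 3)) where
  carrier := {x | IsVelocityField (extendByZero N x)}
  zero_mem' := by
    constructor <;> simp [dotMode_zero]
  add_mem' := by
    intro x y hx hy
    constructor
    · simp [hx.mean_zero, hy.mean_zero]
    · intro k
      simp [dotMode_add, hx.div_free, hy.div_free]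
    · intro k i
      simp [hx.reality, hy.reality]
  smul_mem' := by
    intro c x hx
    constructor
    · simp [hx.mean_zero]
    · intro k
      simp [dotMode_real_smul, hx.div_free]
    · intro k i
      simp [hx.reality]

lemma mem_velocitySpace {N : ℕ} {x : latticeBox N → EuclideanSpace ℂ (Fin 3)} :
    x ∈ velocitySpace N ↔ IsVelocityField (extendByZero N x) := Iff.rfl

lemma IsVelocityField.truncate {a : Coeffs} (ha : IsVelocityField a) (N : ℕ) :
    IsVelocityField fun k => if k ∈ latticeBox N then a k else 0 where
  mean_zero := if_neg fun h => (mem_latticeBox.mp h).1 rfl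
  div_free k := by
    split_ifs
    exacts [ha.div_free k, dotMode_zero k]
  reality k i := by
    simp only [neg_mem_latticeBox]
    split_ifs
    exacts [ha.reality k i, by simp]

/-- A continuous real-linear projection onto the space of velocity fields. -/
lemma exists_velocitySpace_projection (N : ℕ) :
    ∃ π : (latticeBox N → EuclideanSpace ℂ (Fin 3)) →L[ℝ] velocitySpace N,
      ∀ x : velocitySpace N, π x = x := by
  obtain ⟨π, hπ⟩ := (velocitySpace N).subtype.exists_leftInverse_of_injective
    (velocitySpace N).ker_subtype
  exact ⟨π.toContinuousLinearMap, fun x => LinearMap.congr_fun hπ x⟩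

lemma contDiff_dotMode {E : Type*} [NormedAddCommGroup E] [NormedSpace ℝ E] (k : Mode)
    {f : E → EuclideanSpace ℂ (Fin 3)} (hf : ContDiff ℝ 1 f) :
    ContDiff ℝ 1 fun x => dotMode k (f x) := by
  simp only [dotMode_eq_inner]
  exact ((innerSL ℂ (modeVec k)).restrictScalars ℝ).contDiff.comp hf

lemma contDiff_galerkinField {E : Type*} [NormedAddCommGroup E] [NormedSpace ℝ E] (ν : ℝ) (N : ℕ)
    {f : E → Coeffs} (hf : ∀ k, ContDiff ℝ 1 fun x => f x k) (k : Mode) :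
    ContDiff ℝ 1 fun x => galerkinField ν N (f x) k := by
  simp only [galerkinField, nonlinearTerm, interaction, leray]
  refine ContDiff.add (ContDiff.neg (ContDiff.const_smul _ (hf k))) (ContDiff.sum fun p _ => ?_)
  have h : ContDiff ℝ 1 fun x => dotMode (k - p) (f x p) • f x (k - p) :=
    ContDiff.smul (contDiff_dotMode (k - p) (hf p)) (hf (k - p))
  have h' : ContDiff ℝ 1 fun x => (dotMode k (dotMode (k - p) (f x p) • f x (k - p)) /
      (modeAbs k : ℂ) ^ 2) • modeVec k :=
    ContDiff.smul (ContDiff.div_const (contDiff_dotMode k h) _) contDiff_const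
  exact ContDiff.neg (ContDiff.const_smul _ (ContDiff.sub h h'))

/-- The Galerkin system as a vector field on the space of velocity fields. -/
noncomputable def galerkinVectorField (ν : ℝ) (N : ℕ) (x : velocitySpace N) : velocitySpace N :=
  ⟨fun k => galerkinField ν N (extendByZero N x) k, by
    rw [mem_velocitySpace, extendByZero_restrict]
    exact galerkinField_isVelocityField x.2 ν N⟩

lemma contDiff_extendByZero (N : ℕ) (k : Mode) :
    ContDiff ℝ 1 fun x : velocitySpace N => extendByZero N x k := by
  by_cases hk : k ∈ latticeBox N
  · simp only [extendByZero_of_mem _ hk]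
    exact (contDiff_apply ℝ _ (⟨k, hk⟩ : latticeBox N)).comp (velocitySpace N).subtypeL.contDiff
  · simp only [extendByZero_of_notMem _ hk]
    exact contDiff_const

lemma contDiff_galerkinVectorField (ν : ℝ) (N : ℕ) : ContDiff ℝ 1 (galerkinVectorField ν N) := by
  -- Since `π` fixes the values of the field, smoothness may be checked in the ambient space, mode
  -- by mode.
  obtain ⟨π, hπ⟩ := exists_velocitySpace_projection N
  have h : galerkinVectorField ν N =
      fun x : velocitySpace N => π (fun k => galerkinField ν N (extendByZero N x) k) := by
    ext1 x
    rw [← hπ (galerkinVectorField ν N x)]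
    rfl
  rw [h]
  exact π.contDiff.comp (contDiff_pi.mpr fun k =>
    contDiff_galerkinField ν N (contDiff_extendByZero N) k)

lemma hasDerivWithinAt_extendByZero {N : ℕ} {x : ℝ → velocitySpace N} {x' : velocitySpace N}
    {S : Set ℝ} {t : ℝ} (hx : HasDerivWithinAt x x' S t) {k : Mode} (hk : k ∈ latticeBox N) :
    HasDerivWithinAt (fun τ => extendByZero N (x τ) k)
      ((x' : latticeBox N → EuclideanSpace ℂ (Fin 3)) ⟨k, hk⟩) S t := by
  simp only [extendByZero_of_mem _ hk]
  have h := (velocitySpace N).subtypeL.hasFDerivAt.comp_hasDerivWithinAt t hx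
  exact hasDerivWithinAt_pi.mp h ⟨k, hk⟩

/-- Existence, uniqueness and energy bounds for the Galerkin system on a time interval depending
only on the size of the datum. -/
theorem exists_galerkinSolution {s K ν : ℝ} (hs : 0 ≤ s) (hν : 0 < ν) (hK0 : 0 < K)
    (hK : ∀ N a, ∑ k ∈ latticeBox N, ‖a k‖ ≤ K * √(boxEnergy s N a)) (N : ℕ) {m T : ℝ}
    (hm : 0 < m) (hT0 : 0 < T) (hT : T ≤ 3 / (17 * ((2 * 2 ^ s * K) ^ 2 / (2 * ν)) * m ^ 2))
    {u₀ : Coeffs} (hu₀ : IsVelocityField u₀) (h0 : boxEnergy s N u₀ ≤ m ^ 2) :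
    ∃ u : ℝ → Coeffs, IsGalerkinSolution ν N u₀ T u ∧
      ∀ v, IsGalerkinSolution ν N u₀ T v → ∀ t ∈ Set.Icc 0 T, v t = u t := by
  let x₀ : velocitySpace N := ⟨fun k => u₀ k, by
    rw [mem_velocitySpace, extendByZero_restrict]
    exact hu₀.truncate N⟩
  have hx₀ : ∀ k ∈ latticeBox N, extendByZero N x₀ k = u₀ k := fun k hk =>
    extendByZero_of_mem _ hk
  obtain ⟨x, hx0, hx, huniq⟩ := exists_unique_solution_of_apriori_bound
    (contDiff_galerkinVectorField ν N) x₀ (R := 2 * m) hT0 (by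
      intro θ x hθ hx0 hx t ht
      have hE := boxEnergy_le_of_solution hs hν hK0 hK (N := N) hm hT hθ
        (u := fun t => extendByZero N (x t)) (by
          rw [hx0]
          refine le_of_eq_of_le (sum_congr rfl fun k hk => ?_) h0
          rw [hx₀ k hk])
        (fun t _ => (x t).2) (fun t ht k hk => hasDerivWithinAt_extendByZero (hx t ht) hk) t ht
      rw [Submodule.coe_norm, pi_norm_le_iff_of_nonneg (by positivity)]
      rintro ⟨k, hk⟩
      rw [← extendByZero_of_mem (x t : latticeBox N → EuclideanSpace ℂ (Fin 3)) hk]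
      refine (norm_le_sqrt_boxEnergy hs _ hk).trans (Real.sqrt_le_iff.mpr ⟨by positivity, ?_⟩)
      linarith)
  refine ⟨fun t => extendByZero N (x t), ⟨fun t _ => (x t).2,
    fun t _ k hk => extendByZero_of_notMem _ hk, fun k hk => ?_,
    fun t ht k hk => hasDerivWithinAt_extendByZero (hx t ht) hk⟩, fun v hv t ht => ?_⟩
  · rw [hx0, hx₀ k hk]
  -- A competitor `v` is a velocity field only on `[0, T]`; projecting gives a curve in the subspace
  -- at all times that agrees with `v` there.
  · obtain ⟨π, hπ⟩ := exists_velocitySpace_projection N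
    have hπv : ∀ t ∈ Set.Icc 0 T,
        ((π (fun k => v t k) : velocitySpace N) : latticeBox N → EuclideanSpace ℂ (Fin 3)) =
          fun k : latticeBox N => v t k :=
      fun t ht => by
        have hmem : (fun k : latticeBox N => v t k) ∈ velocitySpace N := by
          rw [mem_velocitySpace, extendByZero_restrict_of_support (hv.support t ht)]
          exact hv.velocity t ht
        rw [hπ ⟨_, hmem⟩]
    have hext : ∀ t ∈ Set.Icc 0 T, extendByZero N (π (fun k => v t k)) = v t := fun t ht => by
      rw [hπv t ht, extendByZero_restrict_of_support (hv.support t ht)]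
    have h := huniq (fun t => π (fun k => v t k)) ?_ ?_ t ht
    · exact (hext t ht).symm.trans (by rw [h])
    · have h00 : (0 : ℝ) ∈ Set.Icc 0 T := ⟨le_rfl, hT0.le⟩
      ext1
      rw [hπv 0 h00]
      ext1 k
      exact hv.initial k k.2
    · intro t ht
      have hd : HasDerivWithinAt (fun τ => fun k : latticeBox N => v τ k)
          (fun k : latticeBox N => galerkinField ν N (v t) k) (Set.Icc 0 T) t :=
        hasDerivWithinAt_pi.mpr fun k => hv.ode t ht k k.2
      refine (π.hasFDerivAt.comp_hasDerivWithinAt t hd).congr_deriv ?_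
      rw [← hπ (galerkinVectorField ν N _)]
      congr 1
      ext1 k
      simp only [galerkinVectorField, hext t ht]

/-! ### From box energies to Sobolev norms -/

lemma sum_subtype_latticeBox (N : ℕ) (F : Mode → ℝ) :
    ∑ k ∈ (latticeBox N).subtype (fun k => k ≠ 0), F k = ∑ k ∈ latticeBox N, F k :=
  sum_subtype_of_mem F fun _ hk => (mem_latticeBox.mp hk).1

lemma sqrt_boxEnergy_le_sobolevNorm {s : ℝ} {a : Coeffs} (ha : MemSobolev s a) (N : ℕ) :
    √(boxEnergy s N a) ≤ sobolevNorm s a := by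
  refine Real.sqrt_le_sqrt ?_
  rw [boxEnergy, ← sum_subtype_latticeBox N fun k => modeAbs k ^ (2 * s) * ‖a k‖ ^ 2]
  exact ha.sum_le_tsum _ fun k _ =>
    mul_nonneg (Real.rpow_nonneg (modeAbs_nonneg _) _) (sq_nonneg _)

lemma sobolevNorm_eq_sqrt_boxEnergy {s : ℝ} {N : ℕ} {a : Coeffs}
    (ha : ∀ k ∉ latticeBox N, a k = 0) : sobolevNorm s a = √(boxEnergy s N a) := by
  rw [boxEnergy, ← sum_subtype_latticeBox N fun k => modeAbs k ^ (2 * s) * ‖a k‖ ^ 2, sobolevNorm,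
    tsum_eq_sum (s := (latticeBox N).subtype fun k => k ≠ 0)]
  intro k hk
  rw [ha k (by simpa using hk)]
  simp

lemma orbits_nonempty {N : ℕ} (hN : 1 ≤ N) : Nonempty (orbits N) := by
  have h : (fun _ => 1 : Mode) ∈ latticeBox N :=
    mem_latticeBox.mpr ⟨fun h => one_ne_zero (congrFun h 0), fun _ => by omega⟩
  exact ⟨⟨_, mem_image_of_mem _ h⟩⟩

lemma criticalThreshold_nonneg (N : ℕ) (a : Coeffs) : 0 ≤ criticalThreshold N a :=
  div_nonneg ENNReal.toReal_nonneg (sq_nonneg _)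

lemma sobolevNorm_le_of_isGalerkinSolution {s K ν : ℝ} (hs : 0 ≤ s) (hν : 0 < ν) (hK0 : 0 < K)
    (hK : ∀ N a, ∑ k ∈ latticeBox N, ‖a k‖ ≤ K * √(boxEnergy s N a)) {N : ℕ} {m T : ℝ}
    (hm : 0 < m) (hT : T ≤ 3 / (17 * ((2 * 2 ^ s * K) ^ 2 / (2 * ν)) * m ^ 2))
    {u₀ : Coeffs} (h0 : boxEnergy s N u₀ ≤ m ^ 2) {u : ℝ → Coeffs}
    (hu : IsGalerkinSolution ν N u₀ T u) :
    ∀ t ∈ Set.Icc 0 T, sobolevNorm s (u t) ≤ 2 * m := by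
  intro t ht
  rw [sobolevNorm_eq_sqrt_boxEnergy (hu.support t ht)]
  refine Real.sqrt_le_iff.mpr ⟨by positivity, ?_⟩
  have h0' : boxEnergy s N (u 0) ≤ m ^ 2 := by
    refine le_of_eq_of_le (sum_congr rfl fun k hk => ?_) h0
    rw [hu.initial k hk]
  have := boxEnergy_le_of_solution hs hν hK0 hK hm hT (θ := fun _ => 1)
    (fun _ => ⟨zero_le_one, le_rfl⟩) h0' hu.velocity
    (fun t ht k hk => by rw [one_smul]; exact hu.ode t ht k hk) t ht
  linarith

end GalerkinNS

/-! ### The main theorem -/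

open GalerkinNS in
theorem mainTheorem7 (s : ℝ) (hs : 5 / 2 < s) :
    ∃ C : ℝ, 0 < C ∧
      ∀ ν : ℝ, 0 < ν → ∀ M : ℝ,
        ∃ T : ℝ, 0 < T ∧
          ∀ u₀ : GalerkinNS.Coeffs, GalerkinNS.IsVelocityField u₀ →
            GalerkinNS.MemSobolev s u₀ → GalerkinNS.sobolevNorm s u₀ ≤ M →
            ∃ u : ℕ → ℝ → GalerkinNS.Coeffs,
              (∀ N : ℕ, 1 ≤ N →
                GalerkinNS.IsGalerkinSolution ν N u₀ T (u N) ∧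
                (∀ v : ℝ → GalerkinNS.Coeffs, GalerkinNS.IsGalerkinSolution ν N u₀ T v →
                  ∀ t ∈ Set.Icc 0 T, v t = u N t)) ∧
              (∀ N : ℕ, 1 ≤ N → ∀ t ∈ Set.Icc 0 T,
                GalerkinNS.sobolevNorm s (u N t) ≤ 2 * M) ∧
              (∀ N : ℕ, 1 ≤ N → ∀ t ∈ Set.Icc 0 T,
                GalerkinNS.linftyNorm (GalerkinNS.stretchingMatrix N (u N t)) ≤
                  C * (2 * M) ^ 3) ∧
              (∀ N : ℕ, 1 ≤ N → ∀ t ∈ Set.Icc 0 T,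
                GalerkinNS.criticalThreshold N (u N t) ≤ C * (2 * M) ^ 3 / (N : ℝ) ^ 2) ∧
              TendstoUniformlyOn (fun N t => GalerkinNS.criticalThreshold N (u N t))
                (fun _ => 0) Filter.atTop (Set.Icc 0 T) := by
  have hs0 : 0 ≤ s := by linarith
  obtain ⟨K, hK0, hK⟩ := exists_sum_norm_le (s := s) (by linarith)
  refine ⟨K, hK0, fun ν hν M => ?_⟩
  set c := (2 * 2 ^ s * K) ^ 2 / (2 * ν) with hc_def
  have hc : 0 < c := by positivity
  -- The time is fixed before any datum is given and needs a positive size; for `M ≤ 0` the value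
  -- `1` serves.
  set m₀ : ℝ := if 0 < M then M else 1 with hm₀_def
  have hm₀ : 0 < m₀ := by
    rw [hm₀_def]
    split_ifs with h
    exacts [h, zero_lt_one]
  have hT0 : 0 < 3 / (17 * c * m₀ ^ 2) := by positivity
  set T := 3 / (17 * c * m₀ ^ 2) with hT_def
  refine ⟨T, hT0, fun u₀ hu₀ hmem hM => ?_⟩
  have hM0 : 0 ≤ M := (Real.sqrt_nonneg _).trans hM
  have h0 : ∀ m, M ≤ m → ∀ N, boxEnergy s N u₀ ≤ m ^ 2 := fun m hm N =>
    Real.sqrt_le_left (hM0.trans hm) |>.mp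
      (((sqrt_boxEnergy_le_sobolevNorm hmem N).trans hM).trans hm)
  have hMm₀ : M ≤ m₀ := by
    rw [hm₀_def]
    split_ifs with h
    exacts [le_rfl, by linarith]
  choose u hu using fun N =>
    exists_galerkinSolution hs0 hν hK0 hK N hm₀ hT0 le_rfl hu₀ (h0 m₀ hMm₀ N)
  have hnorm : ∀ N, ∀ t ∈ Set.Icc 0 T, sobolevNorm s (u N t) ≤ 2 * M := by
    intro N t ht
    -- A smaller `m` allows a longer time, so the estimate on `[0, T]` holds for every positive `m`
    -- between `M` and `m₀`.
    have hm : ∀ m, 0 < m → M ≤ m → m ≤ m₀ → sobolevNorm s (u N t) ≤ 2 * m := by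
      intro m hm hMm hmm₀
      refine sobolevNorm_le_of_isGalerkinSolution hs0 hν hK0 hK hm ?_ (h0 m hMm N) (hu N).1
        t ht
      rw [hT_def, ← hc_def]
      gcongr
    rcases hM0.eq_or_lt with rfl | hMpos
    -- For `M = 0` the bound follows by letting `m` tend to `0`; the minimum with `1` keeps `m ≤ m₀
    -- = 1`.
    · refine le_of_forall_pos_le_add fun ε hε => ?_
      have hmin : min (ε / 2) 1 ≤ m₀ := by simp [hm₀_def]
      have := hm (min (ε / 2) 1) (by positivity) (by positivity) hmin
      linarith [min_le_left (ε / 2) 1]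
    · exact hm M hMpos le_rfl hMm₀
  have hV : ∀ N, ∀ t ∈ Set.Icc 0 T,
      linftyNorm (stretchingMatrix N (u N t)) ≤ K * (2 * M) ^ 3 := by
    intro N t ht
    refine (linftyNorm_stretchingMatrix_le (by linarith) hK ((hu N).1.velocity t ht) N).trans ?_
    rw [← sobolevNorm_eq_sqrt_boxEnergy ((hu N).1.support t ht)]
    have : 0 ≤ sobolevNorm s (u N t) := Real.sqrt_nonneg _
    gcongr
    exact hnorm N t ht
  have hcrit : ∀ N : ℕ, 1 ≤ N → ∀ t ∈ Set.Icc 0 T,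
      criticalThreshold N (u N t) ≤ K * (2 * M) ^ 3 / (N : ℝ) ^ 2 := by
    intro N hN t ht
    have := orbits_nonempty hN
    exact div_le_div_of_nonneg_right ((matrixSpectralRadius_le _).trans (hV N t ht)) (sq_nonneg _)
  refine ⟨u, fun N _ => hu N, fun N _ => hnorm N, fun N _ => hV N, hcrit, ?_⟩
  have hlim : Filter.Tendsto (fun N : ℕ => K * (2 * M) ^ 3 / (N : ℝ) ^ 2) Filter.atTop (nhds 0) :=
    tendsto_const_nhds.div_atTop
      ((Filter.tendsto_pow_atTop two_ne_zero).comp tendsto_natCast_atTop_atTop)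
  rw [Metric.tendstoUniformlyOn_iff]
  intro ε hε
  filter_upwards [hlim.eventually (gt_mem_nhds hε), Filter.eventually_ge_atTop 1] with N hN h1 t ht
  rw [dist_zero_left, Real.norm_of_nonneg (criticalThreshold_nonneg _ _)]
  exact (hcrit N h1 t ht).trans_lt hN
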